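/- Consider diagrams of oriented links in the plane, up to planar isotopy and the three Reidemeister moves. Suppose that in some disk a diagram consists of two pairs of strands, each strand of the first pair crossing each strand of the second, such that the strands of one pair are both over those of the other pair at all four crossings (the two strands of a pair do not cross each other). If both pairs are anti-parallel, changing the over/under information of all four crossings is called a pass-move. If one of the pairs is parallel and the other one is anti-parallel, this change is called a $1$-$2$-move (one-two-way pass-move). For an oriented link $L$, the pass-move number $p(L)$ is the minimal number of pass-moves, and the $1$-$2$-move number $nt(L)$ the minimal number of $1$-$2$-moves, in a finite sequence of such moves and isotopies (Reidemeister moves, which are not counted) that turns $L$ into an unknot or an unlink (the value is $\infty$ if there is no such sequence). **Theorem.** Let $K$ be the square knot, that is, the connected sum of a left-hand trefoil and a right-hand trefoil. Then $p(K) = 1$ and $nt(K) = 1$. -/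

import Mathlib

namespace KnotMoves

/-! Oriented link diagrams in the plane, in general position with respect to the height function.

Such a diagram is cut by horizontal lines into slices, each of which contains exactly one local
minimum, local maximum or crossing, next to vertical strands.  A horizontal line meets the diagram
in a list of oriented strands, written from left to right as a `List Bool`, where `true` is a
strand oriented upwards and `false` a strand oriented downwards.  Diagrams are read from bottom to
top. -/

/-- The elementary pieces.
* `cup a` is a local minimum with left end of direction `a` (and right end of direction `!a`);
* `cap a` is a local maximum with left end of direction `a` (and right end of direction `!a`);
* `cross o a b` is a crossing of a strand of direction `a`, running from bottom left to top right,
  with a strand of direction `b`, running from bottom right to top left.  The strand through the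
  bottom left corner is the over-strand if `o = true`, and the under-strand if `o = false`. -/
inductive Piece : Type
  | cup (a : Bool) : Piece
  | cap (a : Bool) : Piece
  | cross (o a b : Bool) : Piece

/-- The strands at the bottom of a piece. -/
def Piece.source : Piece → List Bool
  | .cup _ => []
  | .cap a => [a, !a]
  | .cross _ a b => [a, b]

/-- The strands at the top of a piece. -/
def Piece.target : Piece → List Bool
  | .cup a => [a, !a]
  | .cap _ => []
  | .cross _ a b => [b, a]

/-- A slice of a diagram: a piece with vertical strands on its left and on its right. -/
structure Slice : Type where
  left : List Bool
  piece : Piece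
  right : List Bool

/-- The strands at the bottom of a slice. -/
def Slice.source (e : Slice) : List Bool := e.left ++ e.piece.source ++ e.right

/-- The strands at the top of a slice. -/
def Slice.target (e : Slice) : List Bool := e.left ++ e.piece.target ++ e.right

/-- `IsTangle s w t`: the slices of `w`, stacked from bottom to top, fit together to an oriented
tangle diagram with strands `s` at the bottom and `t` at the top. -/
def IsTangle : List Bool → List Slice → List Bool → Prop
  | s, [], t => s = t
  | s, e :: w, t => e.source = s ∧ IsTangle e.target w t

/-- An oriented link diagram: a tangle diagram without ends. -/
structure LinkDiagram : Type where
  word : List Slice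
  isTangle : IsTangle [] word []

/-- The tangle `w` with vertical strands `l` on its left and `r` on its right. -/
def widen (l r : List Bool) (w : List Slice) : List Slice :=
  w.map fun e => ⟨l ++ e.left, e.piece, e.right ++ r⟩

/-- `D'` arises from `D` by replacing one occurrence of a tangle `u`, inside a rectangle, by a
tangle `v`, where `(u, v)` is one of the pairs in `M`. -/
def LocalMove (M : List Slice → List Slice → Prop) (D D' : LinkDiagram) : Prop :=
  ∃ (u v pre post : List Slice) (l r : List Bool), M u v ∧
    D.word = pre ++ widen l r u ++ post ∧ D'.word = pre ++ widen l r v ++ post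

/-- The planar isotopies and the Reidemeister moves for diagrams that are cut into slices. -/
inductive ReidemeisterPair : List Slice → List Slice → Prop
  /-- Planar isotopy: two pieces at a horizontal distance pass each other in height. -/
  | exchange (g h : Piece) (m : List Bool) :
      ReidemeisterPair
        [⟨[], g, m ++ h.source⟩, ⟨g.target ++ m, h, []⟩]
        [⟨g.source ++ m, h, []⟩, ⟨[], g, m ++ h.target⟩]
  /-- Planar isotopy: a minimum and a maximum on one strand cancel. -/
  | zigzag_left (a : Bool) :
      ReidemeisterPair [⟨[a], .cup (!a), []⟩, ⟨[], .cap a, [a]⟩] []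
  /-- Planar isotopy: a minimum and a maximum on one strand cancel, mirror image. -/
  | zigzag_right (a : Bool) :
      ReidemeisterPair [⟨[], .cup a, [a]⟩, ⟨[a], .cap (!a), []⟩] []
  /-- Planar isotopy: a crossing on one leg of a maximum is turned onto the other leg. -/
  | swing_cap (o a b : Bool) :
      ReidemeisterPair
        [⟨[], .cross o a b, [!a]⟩, ⟨[b], .cap a, []⟩]
        [⟨[a], .cross (!o) b (!a), []⟩, ⟨[], .cap a, [b]⟩]
  /-- Planar isotopy: a crossing on one leg of a minimum is turned onto the other leg. -/
  | swing_cup (o a b : Bool) :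
      ReidemeisterPair
        [⟨[b], .cup a, []⟩, ⟨[], .cross o b a, [!a]⟩]
        [⟨[], .cup a, [b]⟩, ⟨[a], .cross (!o) (!a) b, []⟩]
  /-- First Reidemeister move: a kink at a maximum is removed. -/
  | reidemeister_one_cap (o a : Bool) :
      ReidemeisterPair [⟨[], .cross o a (!a), []⟩, ⟨[], .cap (!a), []⟩] [⟨[], .cap a, []⟩]
  /-- First Reidemeister move: a kink at a minimum is removed. -/
  | reidemeister_one_cup (o a : Bool) :
      ReidemeisterPair [⟨[], .cup a, []⟩, ⟨[], .cross o a (!a), []⟩] [⟨[], .cup (!a), []⟩]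
  /-- Second Reidemeister move. -/
  | reidemeister_two (o a b : Bool) :
      ReidemeisterPair [⟨[], .cross o a b, []⟩, ⟨[], .cross (!o) b a, []⟩] []
  /-- Third Reidemeister move.  Here `o₁`, `o₂`, `o₃` say whether `a` is over `b`, `a` is over `c`,
  `b` is over `c`; the hypothesis says that the three strands lie at three different heights. -/
  | reidemeister_three (o₁ o₂ o₃ a b c : Bool) (height : o₁ = o₂ ∨ o₂ = o₃) :
      ReidemeisterPair
        [⟨[], .cross o₁ a b, [c]⟩, ⟨[b], .cross o₂ a c, []⟩, ⟨[], .cross o₃ b c, [a]⟩]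
        [⟨[a], .cross o₃ b c, []⟩, ⟨[], .cross o₂ a c, [b]⟩, ⟨[c], .cross o₁ a b, []⟩]

/-- Oriented link types: link diagrams up to the equivalence relation generated by planar isotopies
and Reidemeister moves. -/
def Link : Type := Quot (LocalMove ReidemeisterPair)

/-- The link type of a diagram. -/
def LinkDiagram.link (D : LinkDiagram) : Link := Quot.mk _ D

/-- Two strands of directions `a₁`, `a₂`, running from bottom left to top right, cross two strands
of directions `b₁`, `b₂`, running from bottom right to top left.  The first two strands are over
the other two at all four crossings if `o = true`, and under them if `o = false`. -/
def grid (o a₁ a₂ b₁ b₂ : Bool) : List Slice :=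
  [⟨[a₁], .cross o a₂ b₁, [b₂]⟩,
   ⟨[], .cross o a₁ b₁, [a₂, b₂]⟩,
   ⟨[b₁, a₁], .cross o a₂ b₂, []⟩,
   ⟨[b₁], .cross o a₁ b₂, [a₂]⟩]

/-- Pass-move: two anti-parallel strands are over or under two anti-parallel strands, and all four
crossings are changed. -/
inductive PassPair : List Slice → List Slice → Prop
  | mk (o a₁ a₂ b₁ b₂ : Bool) (ha : a₁ ≠ a₂) (hb : b₁ ≠ b₂) :
      PassPair (grid o a₁ a₂ b₁ b₂) (grid (!o) a₁ a₂ b₁ b₂)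

/-- One-two-way pass-move: two parallel strands are over or under two anti-parallel strands, and all
four crossings are changed.  The pair of parallel strands is either one of the two pairs. -/
inductive OneTwoPair : List Slice → List Slice → Prop
  | parallel_left (o a₁ a₂ b₁ b₂ : Bool) (ha : a₁ = a₂) (hb : b₁ ≠ b₂) :
      OneTwoPair (grid o a₁ a₂ b₁ b₂) (grid (!o) a₁ a₂ b₁ b₂)
  | parallel_right (o a₁ a₂ b₁ b₂ : Bool) (ha : a₁ ≠ a₂) (hb : b₁ = b₂) :
      OneTwoPair (grid o a₁ a₂ b₁ b₂) (grid (!o) a₁ a₂ b₁ b₂)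

/-- `L'` arises from `L` by one move of type `M`, performed on some diagram of `L`. -/
def Link.Move (M : List Slice → List Slice → Prop) (L L' : Link) : Prop :=
  ∃ D D' : LinkDiagram, D.link = L ∧ D'.link = L' ∧ LocalMove M D D'

/-- `L'` arises from `L` by exactly `n` moves of type `M`. -/
def Link.Moves (M : List Slice → List Slice → Prop) : ℕ → Link → Link → Prop
  | 0, L, L' => L = L'
  | n + 1, L, L' => ∃ L₁, Link.Move M L L₁ ∧ Link.Moves M n L₁ L'

/-- The standard diagram of the unlink of `n` components: `n` disjoint circles without crossings,
stacked above each other. -/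
def unlinkWord : ℕ → List Slice
  | 0 => []
  | n + 1 => ⟨[], .cup true, []⟩ :: ⟨[], .cap true, []⟩ :: unlinkWord n

theorem unlinkWord_isTangle (n : ℕ) : IsTangle [] (unlinkWord n) [] := by
  induction n with
  | zero => exact rfl
  | succ n ih => exact ⟨rfl, rfl, ih⟩

/-- The unlink of `n` components; it is the unknot for `n = 1`. -/
def unlink (n : ℕ) : Link := LinkDiagram.link ⟨unlinkWord n, unlinkWord_isTangle n⟩

/-- The minimal number of moves of type `M` that turn `L` into an unknot or an unlink; it is `⊤` if
there is no such sequence of moves. -/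
noncomputable def moveNumber (M : List Slice → List Slice → Prop) (L : Link) : ℕ∞ :=
  sInf {k : ℕ∞ | ∃ n c : ℕ, k = n ∧ Link.Moves M n L (unlink c)}

/-- The pass-move number. -/
noncomputable def passNumber (L : Link) : ℕ∞ := moveNumber PassPair L

/-- The one-two-way pass-move number. -/
noncomputable def oneTwoNumber (L : Link) : ℕ∞ := moveNumber OneTwoPair L

/-- The trefoil as a long knot with one end at the bottom and one at the top: the braid with two
upward strands and three equal crossings, whose right strand is closed up on the right.  Upward
strands of which the one from bottom left to top right is over form a positive crossing, hence it is
the right-hand trefoil for `o = true` and the left-hand trefoil for `o = false`. -/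
def longTrefoil (o : Bool) : List Slice :=
  [⟨[true], .cup true, []⟩,
   ⟨[], .cross o true true, [false]⟩,
   ⟨[], .cross o true true, [false]⟩,
   ⟨[], .cross o true true, [false]⟩,
   ⟨[true], .cap true, []⟩]

/-- A long knot, closed up on the right to a link diagram. -/
def closeUp (w : List Slice) : List Slice :=
  ⟨[], .cup true, []⟩ :: (widen [] [false] w ++ [⟨[], .cap true, []⟩])

/-- A diagram of the square knot: the connected sum of a left-hand and a right-hand trefoil, formed
by stacking the two long knots and closing up the result. -/
def squareKnotDiagram : LinkDiagram where
  word := closeUp (longTrefoil false ++ longTrefoil true)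
  isTangle := by
    simp [closeUp, longTrefoil, widen, IsTangle, Slice.source, Slice.target, Piece.source,
      Piece.target]

/-- The square knot. -/
def squareKnot : Link := squareKnotDiagram.link

end KnotMoves

namespace KnotMoves

/-! Lower bound: zero moves do not suffice, because the square knot is no unlink. The number of
colourings by the dihedral quandle on `ZMod 6` is a link invariant (`tangleOp_link`); it is 6^n for
the unlink of n components and 54 = 2 · 27 for the square knot. Modulus 3 alone would give 27 = 3^3,
as for three unlinked circles; the factor from modulus 2 counts components and excludes this. The
count is a product of operators, one for each slice, so invariance reduces to one identity for each
Reidemeister pair.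

Upper bound: for each kind of move there is an explicit diagram containing a suitable `grid`, which
represents the square knot for one choice of over and under in the grid and the unknot for the
other. Each identification is a list of Reidemeister moves, replayed by `rewriteAll` inside the
kernel. -/

/-! ### Colourings by the dihedral quandle

A state is the sequence of colours of the strands met by a horizontal line.  A tangle acts on the
functions of states, by summing over all colourings of the tangle. -/

/-- The additive endomorphisms of the functions of sequences of colours in `X`. -/
abbrev StateOp (X : Type) : Type := AddMonoid.End (Stream' X → ℕ)

/-- The action of a tangle to the right of one more strand. -/
def shift (X : Type) : StateOp X →* StateOp X where
  toFun T :=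
    { toFun := fun f s => T (fun y => f (y.cons s.head)) s.tail
      map_zero' := by
        funext s
        exact congrFun (map_zero T) s.tail
      map_add' := fun f g => by
        funext s
        exact congrFun (map_add T (fun y => f (y.cons s.head)) fun y => g (y.cons s.head)) s.tail }
  map_one' := by
    ext f s
    exact congrArg f (Stream'.eta s)
  map_mul' T U := rfl

theorem shift_apply_cons {X : Type} (T : StateOp X) (f : Stream' X → ℕ) (x : X) (s : Stream' X) :
    shift X T f (s.cons x) = T (fun y => f (y.cons x)) s := rfl

theorem shift_iterate_mul {X : Type} (n : ℕ) (T U : StateOp X) :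
    (shift X)^[n] (T * U) = (shift X)^[n] T * (shift X)^[n] U := by
  induction n generalizing T U with
  | zero => rfl
  | succ n ih => rw [Function.iterate_succ_apply, map_mul, ih]; rfl

theorem shift_iterate_one {X : Type} (n : ℕ) : (shift X)^[n] 1 = 1 := by
  induction n with
  | zero => rfl
  | succ n ih => rw [Function.iterate_succ_apply, map_one, ih]

/-- The action of a local minimum: both ends get the same colour. -/
def cupOp (X : Type) [Fintype X] : StateOp X where
  toFun f s := ∑ c : X, f ((s.cons c).cons c)
  map_zero' := by
    funext s
    simp
  map_add' f g := by
    funext s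
    simp [Finset.sum_add_distrib]

/-- The action of a local maximum: both ends must have the same colour. -/
def capOp (X : Type) [DecidableEq X] : StateOp X where
  toFun f s := if s.head = s.tail.head then f s.tail.tail else 0
  map_zero' := by
    funext s
    simp
  map_add' f g := by
    funext s
    change (if s.head = s.tail.head then f s.tail.tail + g s.tail.tail else 0) =
      (if s.head = s.tail.head then f s.tail.tail else 0) +
        if s.head = s.tail.head then g s.tail.tail else 0
    split_ifs <;> rfl

/-- The action of a crossing: the colour of the under-strand is reflected in the colour of the
over-strand. -/
def crossOp (X : Type) [AddCommGroup X] (o : Bool) : StateOp X where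
  toFun f s :=
    if o then f ((s.tail.tail.cons s.head).cons (s.head + s.head - s.tail.head))
    else f ((s.tail.tail.cons (s.tail.head + s.tail.head - s.head)).cons s.tail.head)
  map_zero' := by
    funext s
    cases o <;> rfl
  map_add' f g := by
    funext s
    cases o <;> rfl

theorem crossOp_true_apply {X : Type} [AddCommGroup X] (f : Stream' X → ℕ) (x y : X) (t : Stream' X) :
    crossOp X true f ((t.cons y).cons x) = f ((t.cons x).cons (x + x - y)) := rfl

theorem crossOp_false_apply {X : Type} [AddCommGroup X] (f : Stream' X → ℕ) (x y : X) (t : Stream' X) :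
    crossOp X false f ((t.cons y).cons x) = f ((t.cons (y + y - x)).cons y) := rfl

/-! ### Invariance of the colouring count -/

section Dihedral

variable {X : Type} [Fintype X] [DecidableEq X] [AddCommGroup X]

/-- The action of a piece. -/
def pieceOp (X : Type) [Fintype X] [DecidableEq X] [AddCommGroup X] : Piece → StateOp X
  | .cup _ => cupOp X
  | .cap _ => capOp X
  | .cross o _ _ => crossOp X o

/-- The action of a tangle. -/
def tangleOp (X : Type) [Fintype X] [DecidableEq X] [AddCommGroup X] (w : List Slice) : StateOp X :=
  (w.map fun e => (shift X)^[e.left.length] (pieceOp X e.piece)).prod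

theorem tangleOp_append (u v : List Slice) :
    tangleOp X (u ++ v) = tangleOp X u * tangleOp X v := by
  simp [tangleOp]

/-- Operators act on the front of an infinite stream, so strands on the right lie in an untouched
tail and `r` plays no role. -/
theorem tangleOp_widen (l r : List Bool) (u : List Slice) :
    tangleOp X (widen l r u) = (shift X)^[l.length] (tangleOp X u) := by
  induction u with
  | nil => exact (shift_iterate_one _).symm
  | cons e u ih =>
    have h : tangleOp X (e :: u) =
      (shift X)^[e.left.length] (pieceOp X e.piece) * tangleOp X u := rfl
    rw [h, shift_iterate_mul, ← ih, ← Function.iterate_add_apply, ← List.length_append]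
    rfl

/-- Distant pieces act on disjoint parts of the state. Additivity of `T` is what lets it pass the
sum over colours at a minimum and the zero at a violated maximum. -/
theorem pieceOp_mul_shift (g : Piece) (T : StateOp X) :
    pieceOp X g * (shift X)^[g.target.length] T = (shift X)^[g.source.length] T * pieceOp X g := by
  ext f s
  cases g with
  | cup a =>
    have h : (fun s : Stream' X => ∑ c : X, f ((s.cons c).cons c)) =
        ∑ c : X, fun s : Stream' X => f ((s.cons c).cons c) := by
      funext s
      simp
    change ∑ c : X, T (fun y => f ((y.cons c).cons c)) s =
      T (fun s => ∑ c : X, f ((s.cons c).cons c)) s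
    rw [h, map_sum, Finset.sum_apply]
  | cap a =>
    change (if s.head = s.tail.head then T f s.tail.tail else 0) =
      T (fun y => if s.head = s.tail.head then f y else 0) s.tail.tail
    by_cases h : s.head = s.tail.head
    · simp only [h, if_true]
    · simp only [h, if_false]
      exact (congrFun (map_zero T) _).symm
  | cross o a b =>
    cases o <;> rfl

/-- Reflection x ↦ 2y - x is an involution, fixes y, and distributes over itself. Orientations are
irrelevant, and nothing is divided by 2, so even moduli are allowed. -/
theorem tangleOp_eq_of_reidemeisterPair {u v : List Slice} (h : ReidemeisterPair u v) :
    tangleOp X u = tangleOp X v := by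
  cases h with
  | exchange g h m =>
    have := pieceOp_mul_shift g ((shift X)^[m.length] (pieceOp X h))
    rw [← Function.iterate_add_apply, ← Function.iterate_add_apply] at this
    simpa [tangleOp] using this
  | zigzag_left a =>
    ext f s
    change (∑ c : X, if s.head = c then f ((s.tail.cons c)) else 0) = f s
    simp
  | zigzag_right a =>
    ext f s
    change (∑ c : X, if c = s.head then f ((s.tail.cons c)) else 0) = f s
    simp
  | swing_cap o a b =>
    ext f s
    cases o
    · change (if s.tail.head + s.tail.head - s.head = s.tail.tail.head then
          f (s.tail.tail.tail.cons s.tail.head) else 0) =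
        if s.head = s.tail.head + s.tail.head - s.tail.tail.head then
          f (s.tail.tail.tail.cons s.tail.head) else 0
      refine if_congr ?_ rfl rfl
      rw [sub_eq_iff_eq_add, eq_sub_iff_add_eq, add_comm s.head, eq_comm]
    · change (if s.head = s.tail.tail.head then
          f (s.tail.tail.tail.cons (s.head + s.head - s.tail.head)) else 0) =
        if s.head = s.tail.tail.head then f (s.tail.tail.tail.cons
          (s.tail.tail.head + s.tail.tail.head - s.tail.head)) else 0
      split_ifs with h
      · rw [h]
      · rfl
  | swing_cup o a b =>
    ext f s
    cases o
    · rfl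
    · change (∑ c : X, f (((s.tail.cons c).cons s.head).cons (s.head + s.head - c))) =
        ∑ c : X, f (((s.tail.cons (s.head + s.head - c)).cons s.head).cons c)
      -- Reflection in the over-colour permutes the colours summed over.
      refine Fintype.sum_equiv (Equiv.subLeft (s.head + s.head)) _ _ fun c => ?_
      simp
  | reidemeister_one_cap o a =>
    ext f s
    cases o
    · change (if s.tail.head = s.tail.head + s.tail.head - s.head then f s.tail.tail else 0) =
        if s.head = s.tail.head then f s.tail.tail else 0
      refine if_congr ?_ rfl rfl
      rw [eq_sub_iff_add_eq, add_right_inj]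
    · change (if s.head + s.head - s.tail.head = s.head then f s.tail.tail else 0) =
        if s.head = s.tail.head then f s.tail.tail else 0
      refine if_congr ?_ rfl rfl
      rw [sub_eq_iff_eq_add, add_right_inj]
  | reidemeister_one_cup o a =>
    ext f s
    cases o
    · change (∑ c : X, f ((s.cons (c + c - c)).cons c)) = ∑ c : X, f ((s.cons c).cons c)
      simp
    · change (∑ c : X, f ((s.cons c).cons (c + c - c))) = ∑ c : X, f ((s.cons c).cons c)
      simp
  | reidemeister_two o a b =>
    ext f s
    rw [← Stream'.eta s, ← Stream'.eta s.tail]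
    generalize s.head = x, s.tail.head = y, s.tail.tail = t
    cases o
    · change f ((t.cons y).cons (y + y - (y + y - x))) = f ((t.cons y).cons x)
      simp
    · change f ((t.cons (x + x - (x + x - y))).cons x) = f ((t.cons y).cons x)
      simp
  | reidemeister_three o₁ o₂ o₃ a b c height =>
    ext f s
    rw [← Stream'.eta s, ← Stream'.eta s.tail, ← Stream'.eta s.tail.tail]
    generalize s.head = x, s.tail.head = y, s.tail.tail.head = z, s.tail.tail.tail = t
    -- `height` discards the two cases of strands lying cyclically above each other.
    rcases o₁ with _ | _ <;> rcases o₂ with _ | _ <;> rcases o₃ with _ | _ <;>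
      simp at height <;>
      simp only [tangleOp, List.map_cons, List.map_nil, List.prod_cons, List.prod_nil, mul_one,
        AddMonoid.End.coe_mul, Function.comp_apply, pieceOp, List.length_cons, List.length_nil, Nat.zero_add,
        Function.iterate_zero_apply, Function.iterate_one, shift_apply_cons, crossOp_true_apply,
        crossOp_false_apply] <;>
      refine congrArg f (congrArg₂ _ ?_ (congrArg₂ _ ?_ (congrArg₂ _ ?_ rfl))) <;>
      abel

theorem tangleOp_link {D D' : LinkDiagram} (h : D.link = D'.link) :
    tangleOp X D.word = tangleOp X D'.word := by
  refine congrArg (Quot.lift (fun D : LinkDiagram => tangleOp X D.word) ?_) h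
  rintro D D' ⟨u, v, pre, post, l, r, huv, hD, hD'⟩
  simp only [hD, hD', tangleOp_append, tangleOp_widen, tangleOp_eq_of_reidemeisterPair huv]

theorem tangleOp_unlinkWord (n : ℕ) (s : Stream' X) :
    tangleOp X (unlinkWord n) (fun _ => 1) s = Fintype.card X ^ n := by
  induction n generalizing s with
  | zero => rfl
  | succ n ih =>
    change (∑ c : X, if c = c then tangleOp X (unlinkWord n) (fun _ => 1) s else 0) = _
    simp [ih, pow_succ, mul_comm]

end Dihedral

/-! ### The square knot is not an unlink -/

theorem tangleOp_squareKnot :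
    tangleOp (ZMod 6) squareKnotDiagram.word (fun _ => 1) (Stream'.const 0) = 54 := by
  decide +kernel

theorem squareKnot_ne_unlink (n : ℕ) : squareKnot ≠ unlink n := by
  intro h
  -- The constant function 1 counts colourings; any stream would do, as links have no ends.
  have h1 := congrArg (fun T : StateOp (ZMod 6) => T (fun _ => 1) (Stream'.const 0))
    (tangleOp_link (X := ZMod 6) h)
  simp only [tangleOp_squareKnot, tangleOp_unlinkWord, ZMod.card] at h1
  -- 54 lies strictly between 6^2 and 6^3.
  rcases Nat.lt_or_ge n 3 with hn | hn
  · interval_cases n <;> simp at h1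
  · have := Nat.pow_le_pow_right (show 0 < 6 by norm_num) hn
    omega

/-! ### Verified rewriting of diagrams -/

instance decidableIsTangle (s : List Bool) (w : List Slice) (t : List Bool) :
    Decidable (IsTangle s w t) :=
  match w with
  | [] => inferInstanceAs (Decidable (s = t))
  | e :: w =>
    have := decidableIsTangle e.target w t
    inferInstanceAs (Decidable (e.source = s ∧ IsTangle e.target w t))

/-- An injective encoding of the pieces. -/
def Piece.encode : Piece → ℕ × Bool × Bool × Bool
  | .cup a => (0, a, a, a)
  | .cap a => (1, a, a, a)
  | .cross o a b => (2, o, a, b)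

theorem Piece.encode_injective : Function.Injective Piece.encode := by
  rintro (_ | _ | _) (_ | _ | _) h <;> simp_all [Piece.encode]

instance : DecidableEq Piece := Piece.encode_injective.decidableEq

theorem Slice.encode_injective :
    Function.Injective fun e : Slice => (e.left, e.piece, e.right) := by
  rintro ⟨l, p, r⟩ ⟨l', p', r'⟩ h
  simpa using h

instance : DecidableEq Slice := Slice.encode_injective.decidableEq

/-- The kinds of simplifications of a diagram at a given height. -/
inductive RewriteKind : Type
  | exchangeRight
  | exchangeLeft
  | zigzag
  | swing
  | kink
  | bigon
  | triangle

/-- A pair of tangles that are related by a Reidemeister move, in one of the two directions. -/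
abbrev Redex : Type :=
  {p : List Slice × List Slice // ReidemeisterPair p.1 p.2 ∨ ReidemeisterPair p.2 p.1}

/-- The tangles by which a simplification replaces the bottom slices of a tangle. -/
def redex : RewriteKind → List Slice → Option Redex
  | .exchangeRight, ⟨l, g, _⟩ :: ⟨l', h, _⟩ :: _ =>
    -- Unification reads both tangles off the constructor. Whether the first one really occurs in
    -- the diagram is left to `rewriteAt`.
    some ⟨(_, _), .inl (.exchange g h (l'.drop (l.length + g.target.length)))⟩
  | .exchangeLeft, ⟨l, h, _⟩ :: ⟨l', g, _⟩ :: _ =>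
    some ⟨(_, _), .inr (.exchange g h (l.drop (l'.length + g.source.length)))⟩
  | .zigzag, ⟨l, .cup a, _⟩ :: ⟨l', .cap b, _⟩ :: _ =>
    if l'.length < l.length then some ⟨(_, _), .inl (.zigzag_left b)⟩
    else some ⟨(_, _), .inl (.zigzag_right a)⟩
  | .swing, ⟨l, .cross o a b, _⟩ :: ⟨l', .cap c, _⟩ :: _ =>
    if l.length < l'.length then some ⟨(_, _), .inl (.swing_cap o a b)⟩
    else some ⟨(_, _), .inr (.swing_cap (!o) c a)⟩
  | .swing, ⟨l, .cup a, _⟩ :: ⟨l', .cross o b c, _⟩ :: _ =>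
    if l'.length < l.length then some ⟨(_, _), .inl (.swing_cup o a b)⟩
    else some ⟨(_, _), .inr (.swing_cup (!o) a c)⟩
  | .kink, ⟨_, .cross o a _, _⟩ :: ⟨_, .cap _, _⟩ :: _ =>
    some ⟨(_, _), .inl (.reidemeister_one_cap o a)⟩
  | .kink, ⟨_, .cup a, _⟩ :: ⟨_, .cross o _ _, _⟩ :: _ =>
    some ⟨(_, _), .inl (.reidemeister_one_cup o a)⟩
  | .bigon, ⟨_, .cross o a b, _⟩ :: _ => some ⟨(_, _), .inl (.reidemeister_two o a b)⟩
  | .triangle, ⟨l, .cross o₁ a b, _⟩ :: ⟨l', .cross o₂ c d, _⟩ :: ⟨_, .cross o₃ e f, _⟩ :: _ =>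
    if h : o₁ = o₂ ∨ o₂ = o₃ then
      if l.length < l'.length then some ⟨(_, _), .inl (.reidemeister_three o₁ o₂ o₃ a b d h)⟩
      else some ⟨(_, _), .inr (.reidemeister_three o₃ o₂ o₁ c a b (by tauto))⟩
    else none
  | _, _ => none

/-- The difference of the strands on the left and on the right of the bottom slices of two
tangles. -/
def margins : List Slice → List Slice → List Bool × List Bool
  | e :: _, e' :: _ =>
    (e.left.take (e.left.length - e'.left.length), e.right.drop e'.right.length)
  | _, _ => ([], [])

/-- Simplify a link diagram at the height `k`. -/
def rewriteAt (c : RewriteKind) (k : ℕ) (w : List Slice) : Option (List Slice) :=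
  match redex c (w.drop k) with
  | none => none
  | some p =>
    let m := margins (w.drop k) p.1.1
    let w' := w.take k ++ widen m.1 m.2 p.1.2 ++ w.drop (k + p.1.1.length)
    -- This test makes rewriting sound: a wrong guess by `redex` or `margins` only yields `none`.
    if w = w.take k ++ widen m.1 m.2 p.1.1 ++ w.drop (k + p.1.1.length) ∧ IsTangle [] w' [] then
      some w'
    else none

/-- A sequence of simplifications of a link diagram. -/
def rewriteAll : List (RewriteKind × ℕ) → List Slice → Option (List Slice)
  | [], w => some w
  | (c, k) :: cs, w => (rewriteAt c k w).bind (rewriteAll cs)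

theorem exists_link_eq_of_rewriteAt {c : RewriteKind} {k : ℕ} {w w' : List Slice}
    (h : rewriteAt c k w = some w') (hw : IsTangle [] w []) :
    ∃ hw' : IsTangle [] w' [], LinkDiagram.link ⟨w, hw⟩ = LinkDiagram.link ⟨w', hw'⟩ := by
  unfold rewriteAt at h
  split at h
  · simp at h
  · next p _ =>
    dsimp only at h
    split_ifs at h with hc
    obtain rfl := Option.some.inj h
    refine ⟨hc.2, ?_⟩
    rcases p.2 with hp | hp
    · exact Quot.sound ⟨_, _, _, _, _, _, hp, hc.1, rfl⟩
    · exact (Quot.sound ⟨_, _, _, _, _, _, hp, rfl, hc.1⟩).symm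

theorem exists_link_eq_of_rewriteAll {cs : List (RewriteKind × ℕ)} {w w' : List Slice}
    (h : rewriteAll cs w = some w') (hw : IsTangle [] w []) :
    ∃ hw' : IsTangle [] w' [], LinkDiagram.link ⟨w, hw⟩ = LinkDiagram.link ⟨w', hw'⟩ := by
  induction cs generalizing w with
  | nil =>
    obtain rfl := Option.some.inj h
    exact ⟨hw, rfl⟩
  | cons c cs ih =>
    obtain ⟨v, hv, hv'⟩ := Option.bind_eq_some_iff.1 h
    obtain ⟨h₁, h₂⟩ := exists_link_eq_of_rewriteAt hv hw
    obtain ⟨h₃, h₄⟩ := ih hv' h₁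
    exact ⟨h₃, h₂.trans h₄⟩

/-- Two link diagrams with a common simplification have the same link type. -/
theorem link_eq_of_rewriteAll (cs cs' : List (RewriteKind × ℕ)) {D D' : LinkDiagram}
    (h : (rewriteAll cs D.word).isSome = true)
    (h' : rewriteAll cs D.word = rewriteAll cs' D'.word) : D.link = D'.link := by
  obtain ⟨w, hw⟩ := Option.isSome_iff_exists.1 h
  obtain ⟨_, h₁⟩ := exists_link_eq_of_rewriteAll hw D.isTangle
  obtain ⟨_, h₂⟩ := exists_link_eq_of_rewriteAll (h'.symm.trans hw) D'.isTangle
  exact h₁.trans h₂.symm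

/-! ### Diagrams of the square knot and of the unknot that are related by one move -/

/-- A diagram of the unknot with one crossing. -/
def kinkDiagram : LinkDiagram where
  word := [⟨[], .cup true, []⟩, ⟨[], .cross true true false, []⟩, ⟨[], .cap false, []⟩]
  isTangle := by decide +kernel

theorem link_kinkDiagram : kinkDiagram.link = unlink 1 :=
  link_eq_of_rewriteAll [(.kink, 1)] [] (by decide +kernel) (by decide +kernel)

/-- A link diagram that contains a grid.  It is a diagram of the square knot for `o = false` and of
the unknot for `o = true`. -/
def passWord (o : Bool) : List Slice :=
  [⟨[], .cup true, []⟩,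
    ⟨[true, false], .cup true, []⟩,
    ⟨[true, false, true], .cup true, [false]⟩,
    ⟨[true, false], .cross false true true, [false, false]⟩,
    ⟨[true, false], .cross false true true, [false, false]⟩] ++
    widen [true] [false] (grid o false true true false) ++
  [⟨[true, true, false], .cross false false true, [false]⟩,
    ⟨[], .cross true true true, [false, true, false, false]⟩,
    ⟨[], .cross true true true, [false, true, false, false]⟩,
    ⟨[true, true], .cap false, [false, false]⟩,
    ⟨[true], .cap true, [false]⟩,
    ⟨[], .cap true, []⟩]

theorem passWord_isTangle (o : Bool) : IsTangle [] (passWord o) [] := by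
  cases o <;> decide +kernel

/-- The link diagram of `passWord`. -/
def passDiagram (o : Bool) : LinkDiagram := ⟨passWord o, passWord_isTangle o⟩

/-- One kink and one bigon reduce nine crossings to six; isotopies then match the result with an
isotoped standard diagram. -/
theorem link_passDiagram_false : (passDiagram false).link = squareKnot :=
  link_eq_of_rewriteAll
    [(.triangle, 7), (.exchangeLeft, 9), (.exchangeLeft, 10), (.kink, 11),
      (.exchangeLeft, 8), (.exchangeLeft, 9), (.swing, 10), (.exchangeLeft, 7),
      (.exchangeLeft, 8), (.bigon, 9), (.exchangeLeft, 9)]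
    [(.exchangeLeft, 5), (.exchangeLeft, 6), (.exchangeLeft, 7), (.exchangeLeft, 8),
      (.exchangeLeft, 9), (.swing, 5), (.exchangeLeft, 4), (.exchangeLeft, 3),
      (.exchangeLeft, 2), (.exchangeLeft, 1), (.exchangeLeft, 0)]
    (by decide +kernel) (by decide +kernel)

theorem link_passDiagram_true : (passDiagram true).link = unlink 1 :=
  link_eq_of_rewriteAll
    [(.bigon, 4), (.triangle, 5), (.exchangeLeft, 7), (.exchangeLeft, 8), (.kink, 9),
      (.exchangeRight, 0), (.exchangeRight, 1), (.exchangeRight, 2), (.swing, 3),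
      (.exchangeRight, 4), (.exchangeRight, 5), (.bigon, 6), (.exchangeRight, 6), (.swing, 7),
      (.swing, 5), (.swing, 3), (.exchangeLeft, 6), (.triangle, 4), (.kink, 3), (.swing, 3),
      (.exchangeLeft, 6), (.exchangeLeft, 5), (.exchangeLeft, 4), (.zigzag, 3), (.bigon, 2),
      (.swing, 1), (.kink, 2), (.zigzag, 1)]
    [] (by decide +kernel) (by decide +kernel)

theorem pass_move_squareKnot : Link.Move PassPair squareKnot (unlink 1) :=
  ⟨_, _, link_passDiagram_false, link_passDiagram_true, _, _, _, _, _, _,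
    -- The two words differ only in the flag of the grid, so `rfl` finds its surroundings.
    .mk false false true true false (by decide) (by decide), rfl, rfl⟩

/-- A link diagram that contains a grid.  It is a diagram of the square knot for `o = false` and of
the unknot for `o = true`. -/
def oneTwoWord (o : Bool) : List Slice :=
  [⟨[], .cup false, []⟩,
    ⟨[false, true], .cup true, []⟩,
    ⟨[false, true, true], .cup true, [false]⟩,
    ⟨[false], .cross true true true, [true, false, false]⟩] ++
    widen [] [false, false] (grid o false true true true) ++
  [⟨[], .cross true true true, [false, true, false, false]⟩,
    ⟨[true], .cross false true false, [true, false, false]⟩,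
    ⟨[true, false], .cross false true true, [false, false]⟩,
    ⟨[true, false], .cross false true true, [false, false]⟩,
    ⟨[true, false, true], .cap true, [false]⟩,
    ⟨[true, false], .cap true, []⟩,
    ⟨[], .cap true, []⟩]

theorem oneTwoWord_isTangle (o : Bool) : IsTangle [] (oneTwoWord o) [] := by
  cases o <;> decide +kernel

/-- The link diagram of `oneTwoWord`. -/
def oneTwoDiagram (o : Bool) : LinkDiagram := ⟨oneTwoWord o, oneTwoWord_isTangle o⟩

theorem link_oneTwoDiagram_false : (oneTwoDiagram false).link = squareKnot :=
  link_eq_of_rewriteAll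
    [(.bigon, 3), (.exchangeRight, 0), (.exchangeRight, 1), (.kink, 2), (.swing, 8),
      (.exchangeRight, 9), (.swing, 8), (.exchangeRight, 2), (.swing, 3), (.exchangeRight, 7),
      (.exchangeRight, 6), (.exchangeRight, 5), (.exchangeRight, 4), (.exchangeRight, 3),
      (.exchangeRight, 2), (.swing, 1), (.exchangeLeft, 10), (.exchangeLeft, 9),
      (.exchangeLeft, 8)]
    [(.exchangeLeft, 5), (.exchangeLeft, 6), (.exchangeLeft, 7), (.exchangeLeft, 8),
      (.exchangeLeft, 9), (.swing, 8), (.swing, 1), (.exchangeLeft, 0), (.swing, 1),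
      (.exchangeLeft, 2), (.exchangeLeft, 3), (.exchangeLeft, 4), (.exchangeLeft, 5),
      (.exchangeLeft, 6), (.exchangeLeft, 7), (.exchangeLeft, 8), (.swing, 9),
      (.exchangeLeft, 10), (.swing, 9), (.swing, 1), (.exchangeLeft, 0)]
    (by decide +kernel) (by decide +kernel)

theorem link_oneTwoDiagram_true : (oneTwoDiagram true).link = unlink 1 :=
  -- The simplification ends in a circle oriented oppositely to the standard one. `kinkDiagram`
  -- joins the two: undoing its kink at the minimum gives one orientation, at the maximum the other.
  (link_eq_of_rewriteAll (D' := kinkDiagram)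
    [(.triangle, 7), (.exchangeRight, 5), (.bigon, 6), (.exchangeRight, 7),
      (.exchangeRight, 8), (.exchangeRight, 9), (.exchangeRight, 10), (.kink, 11),
      (.triangle, 5), (.bigon, 4), (.triangle, 4), (.bigon, 3), (.swing, 2),
      (.exchangeLeft, 3), (.kink, 4), (.exchangeRight, 3), (.zigzag, 2), (.swing, 1),
      (.kink, 2), (.zigzag, 1)]
    [(.kink, 0)] (by decide +kernel) (by decide +kernel)).trans link_kinkDiagram

theorem oneTwo_move_squareKnot : Link.Move OneTwoPair squareKnot (unlink 1) :=
  ⟨_, _, link_oneTwoDiagram_false, link_oneTwoDiagram_true, _, _, _, _, _, _,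
    .parallel_right false false true true true (by decide) (by decide), rfl, rfl⟩

theorem moveNumber_eq_one {M : List Slice → List Slice → Prop}
    (h : Link.Move M squareKnot (unlink 1)) : moveNumber M squareKnot = 1 := by
  refine le_antisymm (sInf_le ⟨1, 1, rfl, unlink 1, h, rfl⟩) (le_sInf ?_)
  rintro _ ⟨n, c, rfl, hn⟩
  cases n with
  | zero => exact absurd hn (squareKnot_ne_unlink c)
  | succ n => exact_mod_cast Nat.succ_pos n

end KnotMoves

theorem theorem4p1 :
    KnotMoves.passNumber KnotMoves.squareKnot = 1 ∧
      KnotMoves.oneTwoNumber KnotMoves.squareKnot = 1 :=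
  ⟨KnotMoves.moveNumber_eq_one KnotMoves.pass_move_squareKnot,
    KnotMoves.moveNumber_eq_one KnotMoves.oneTwo_move_squareKnot⟩
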